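/- Let $\mathcal G$ be a locally compact, not necessarily Hausdorff, étale groupoid: a groupoid with a locally compact topology such that the groupoid operations are continuous, the unit space $\mathcal G^{(0)}\subset\mathcal G$ is locally compact Hausdorff in the relative topology, and the range and source maps $r,s\colon\mathcal G\to\mathcal G^{(0)}$ are local homeomorphisms. Write $\mathcal G_x=s^{-1}(x)$, $\mathcal G^x=r^{-1}(x)$, and $\mathcal G^x_x=\mathcal G_x\cap\mathcal G^x$ for the isotropy group at $x\in\mathcal G^{(0)}$. An open bisection is an open set $U\subset\mathcal G$ on which $r$ and $s$ are injective. Let $C_c(\mathcal G)$ be the linear span, in the space of all functions $\mathcal G\to\mathbb C$, of the continuous compactly supported functions on open Hausdorff subsets $V\subset\mathcal G$, extended by zero to $\mathcal G$. With the convolution product and the involution $f^*(g)=\overline{f(g^{-1})}$ it is a $*$-algebra. For $x\in\mathcal G^{(0)}$ it is represented on $\ell^2(\mathcal G_x)$ by $$(\rho_x(f)\xi)(g)=\sum_{h\in\mathcal G^{r(g)}}f(h)\,\xi(h^{-1}g).$$ Let $C^*_r(\mathcal G)$ be the completion of $C_c(\mathcal G)$ in the norm $\|f\|_r=\sup_{x\in\mathcal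 G^{(0)}}\|\rho_x(f)\|$; each $\rho_x$ extends to a representation of $C^*_r(\mathcal G)$. A representation $\pi$ of a C$^*$-algebra is weakly contained in a representation $\sigma$ if $\ker\sigma\subset\ker\pi$. **Proposition.** Let $Y\subset\mathcal G^{(0)}$ be $\mathcal G$-invariant (for $g\in\mathcal G$, $s(g)\in Y$ if and only if $r(g)\in Y$), and let $x\in\mathcal G^{(0)}\setminus Y$. Suppose that, for some $n\ge1$, there are elements $g_1,\dots,g_n\in\mathcal G^x_x\setminus\{x\}$, open bisections $U_1,\dots,U_n$ with $g_k\in U_k$, and a neighbourhood $U$ of $x$ in $\mathcal G^{(0)}$ such that $Y\cap U\subset U_1\cup\dots\cup U_n$, and that $$\sum_{k=1}^n\frac1{\operatorname{ord}(g_k)}<1,$$ where $\operatorname{ord}(g_k)\in\{2,3,\dots,+\infty\}$ is the order of $g_k$ in the group $\mathcal G^x_x$ and $1/\infty=0$. Then the representation $\rho_x$ of $C^*_r(\mathcal G)$ is not weakly contained in $\bigoplus_{y\in Y}\rho_y$. -/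

import Mathlib

open scoped ENNReal NNReal Topology
open Set

noncomputable section

/-- A (small) groupoid given by its set `G` of arrows.  The unit space is identified with the set
of arrows `g` such that `src g = g`; `src g` and `rng g` are the source and the range of `g`,
viewed as units.  Products `g * h` are meaningful only for composable pairs, that is, when
`src g = rng h`; no axiom concerns the other values of `*`, and they are never used. -/
class ArrowGroupoid (G : Type*) extends Mul G, Inv G where
  src : G → G
  rng : G → G
  src_src : ∀ g, src (src g) = src g
  rng_src : ∀ g, rng (src g) = src g
  src_rng : ∀ g, src (rng g) = rng g
  rng_rng : ∀ g, rng (rng g) = rng g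
  src_mul : ∀ g h, src g = rng h → src (g * h) = src h
  rng_mul : ∀ g h, src g = rng h → rng (g * h) = rng g
  mul_assoc' : ∀ g h k, src g = rng h → src h = rng k → g * h * k = g * (h * k)
  mul_src : ∀ g, g * src g = g
  rng_mul_self : ∀ g, rng g * g = g
  src_inv : ∀ g, src g⁻¹ = rng g
  rng_inv : ∀ g, rng g⁻¹ = src g
  inv_mul_self : ∀ g, g⁻¹ * g = src g
  mul_inv_self : ∀ g, g * g⁻¹ = rng g

namespace ArrowGroupoid

variable (G : Type*) [ArrowGroupoid G]

/-- The unit space `G⁽⁰⁾ ⊆ G`. -/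
abbrev UnitSpace : Type _ := {x : G // src x = x}

variable {G}

/-- The source map as a map into the unit space. -/
def srcMap (g : G) : UnitSpace G := ⟨src g, src_src g⟩

/-- The range map as a map into the unit space. -/
def rngMap (g : G) : UnitSpace G := ⟨rng g, src_rng g⟩

/-- The fibre `G_x = s⁻¹(x)`. -/
abbrev SrcFiber (x : UnitSpace G) : Type _ := {g : G // src g = (x : G)}

/-- The fibre `G^u = r⁻¹(u)`. -/
abbrev RngFiber (u : G) : Type _ := {h : G // rng h = u}

/-- The arrow `h⁻¹ g ∈ G_x` for `g ∈ G_x` and `h ∈ G^{r(g)}`. -/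
def invMul {x : UnitSpace G} (g : SrcFiber x) (h : RngFiber (rng (g : G))) : SrcFiber x :=
  ⟨(h : G)⁻¹ * g, by rw [src_mul _ _ (by rw [src_inv, h.2]), g.2]⟩

/-- A subset `Y` of the unit space is invariant if an arrow has its source in `Y` if and only if
it has its range in `Y`. -/
def IsInvariant (Y : Set (UnitSpace G)) : Prop :=
  ∀ g : G, srcMap g ∈ Y ↔ rngMap g ∈ Y

lemma rng_unit (x : UnitSpace G) : rng (x : G) = x := by
  have h := rng_src (x : G)
  rwa [x.2] at h

/-- The isotropy group `G_x^x = G_x ∩ G^x`. -/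
def Isotropy (x : UnitSpace G) : Type _ := {g : G // src g = (x : G) ∧ rng g = (x : G)}

/-- The isotropy group `G_x^x` with the operations of `G`; its identity is the unit `x`. -/
instance (x : UnitSpace G) : Group (Isotropy x) where
  mul g h := ⟨g.1 * h.1, by
    have e : src g.1 = rng h.1 := by rw [g.2.1, h.2.2]
    exact ⟨by rw [src_mul _ _ e, h.2.1], by rw [rng_mul _ _ e, g.2.2]⟩⟩
  one := ⟨x.1, x.2, rng_unit x⟩
  inv g := ⟨g.1⁻¹, by rw [src_inv, g.2.2], by rw [rng_inv, g.2.1]⟩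
  mul_assoc g h k := Subtype.ext <|
    mul_assoc' g.1 h.1 k.1 (by rw [g.2.1, h.2.2]) (by rw [h.2.1, k.2.2])
  one_mul g := Subtype.ext <| by
    have := rng_mul_self g.1
    rw [g.2.2] at this
    exact this
  mul_one g := Subtype.ext <| by
    have := mul_src g.1
    rw [g.2.1] at this
    exact this
  inv_mul_cancel g := Subtype.ext <| by
    have := inv_mul_self g.1
    rw [g.2.1] at this
    exact this

end ArrowGroupoid

open ArrowGroupoid

/-- A locally compact, not necessarily Hausdorff, étale groupoid. -/
class EtaleGroupoid (G : Type*) [TopologicalSpace G] extends ArrowGroupoid G where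
  locallyCompact : LocallyCompactSpace G
  continuousOn_mul : ContinuousOn (fun p : G × G => p.1 * p.2) {p | src p.1 = rng p.2}
  continuous_inv : Continuous (fun g : G => g⁻¹)
  locallyCompact_units : LocallyCompactSpace (UnitSpace G)
  t2_units : T2Space (UnitSpace G)
  isLocalHomeomorph_src : IsLocalHomeomorph (srcMap : G → UnitSpace G)
  isLocalHomeomorph_rng : IsLocalHomeomorph (rngMap : G → UnitSpace G)

/-- An open bisection: an open set of arrows on which source and range are injective (hence, for an
étale groupoid, homeomorphisms onto open subsets of the unit space). -/
def IsOpenBisection {G : Type*} [TopologicalSpace G] [EtaleGroupoid G] (U : Set G) : Prop :=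
  IsOpen U ∧ InjOn src U ∧ InjOn rng U

/-- The space `C_c(G)`: the linear span, in the space of all functions on `G`, of the functions
that vanish outside some open Hausdorff set `V` and whose restriction to `V` is continuous with
compact support. -/
def Cc (G : Type*) [TopologicalSpace G] : Submodule ℂ (G → ℂ) :=
  Submodule.span ℂ {f | ∃ V : Set G, IsOpen V ∧ T2Space V ∧ ContinuousOn f V ∧
    ∃ K ⊆ V, IsCompact K ∧ ∀ g ∉ K, f g = 0}

/-- The Hilbert space `ℓ²(I)`. -/
abbrev Ell2 (I : Type*) : Type _ := lp (fun _ : I => ℂ) 2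

/-! ### Boundedness of the regular representations -/

namespace RegBound

/-- `‖f‖_{ℓ¹}` is uniformly bounded on the fibres of `φ`. -/
def FiberBdd {G X : Type*} (φ : G → X) (f : G → ℂ) (C : ℝ≥0) : Prop :=
  ∀ u : X, ∑' h : {h : G // φ h = u}, ‖f h‖ₑ ≤ C

lemma exists_fiberBdd {G X : Type*} [TopologicalSpace G] {φ : G → X}
    (hφ : ∀ g : G, ∃ W : Set G, IsOpen W ∧ g ∈ W ∧ InjOn φ W) {f : G → ℂ} (hf : f ∈ Cc G) :
    ∃ C, FiberBdd φ f C := by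
  induction hf using Submodule.span_induction with
  | mem f hf =>
    obtain ⟨V, -, -, hc, K, hKV, hK, hz⟩ := hf
    obtain ⟨M, hM⟩ := hK.exists_bound_of_continuousOn (hc.mono hKV)
    choose W hWo hWm hWi using hφ
    obtain ⟨t, ht⟩ := hK.elim_finite_subcover W hWo (fun g _ => mem_iUnion.2 ⟨g, hWm g⟩)
    refine ⟨t.card * M.toNNReal, fun u => ?_⟩
    have hpt : ∀ h : G, ‖f h‖ₑ ≤ ∑ i ∈ t, (W i).indicator (fun _ => ENNReal.ofReal M) h := by
      intro h
      by_cases hh : h ∈ K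
      · obtain ⟨i, hi, hiW⟩ := mem_iUnion₂.1 (ht hh)
        refine le_trans ?_ (Finset.single_le_sum (f := fun i =>
          (W i).indicator (fun _ => ENNReal.ofReal M) h) (fun _ _ => zero_le) hi)
        simp only [indicator_of_mem hiW]
        rw [← ofReal_norm]
        exact ENNReal.ofReal_le_ofReal (hM h hh)
      · simp [hz h hh]
    calc ∑' h : {h : G // φ h = u}, ‖f h‖ₑ
        ≤ ∑' h : {h : G // φ h = u}, ∑ i ∈ t, (W i).indicator (fun _ => ENNReal.ofReal M) (h : G) :=
          ENNReal.tsum_le_tsum fun h => hpt h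
      _ = ∑ i ∈ t, ∑' h : {h : G // φ h = u}, (W i).indicator (fun _ => ENNReal.ofReal M) (h : G) :=
          Summable.tsum_finsetSum fun _ _ => ENNReal.summable
      _ ≤ ∑ _i ∈ t, ENNReal.ofReal M := by
          refine Finset.sum_le_sum fun i _ => ?_
          by_cases hex : ∃ h : {h : G // φ h = u}, (h : G) ∈ W i
          · obtain ⟨h, hh⟩ := hex
            rw [tsum_eq_single h]
            · exact indicator_le_self' (fun _ _ => zero_le) _
            · intro h' hne
              refine indicator_of_notMem (fun hm => hne (Subtype.ext ?_)) _
              exact hWi i hm hh (h'.2.trans h.2.symm)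
          · push Not at hex
            rw [ENNReal.tsum_eq_zero.2 fun h => indicator_of_notMem (hex h) _]
            exact zero_le
      _ = _ := by simp [ENNReal.ofReal]
  | zero => exact ⟨0, fun u => by simp⟩
  | add f g _ _ hf hg =>
    obtain ⟨C, hC⟩ := hf
    obtain ⟨D, hD⟩ := hg
    refine ⟨C + D, fun u => ?_⟩
    calc _ ≤ ∑' h : {h : G // φ h = u}, (‖f h‖ₑ + ‖g h‖ₑ) :=
          ENNReal.tsum_le_tsum fun h => enorm_add_le _ _
      _ ≤ _ := by
          rw [ENNReal.tsum_add]
          push_cast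
          exact add_le_add (hC u) (hD u)
  | smul c f _ hf =>
    obtain ⟨C, hC⟩ := hf
    refine ⟨‖c‖₊ * C, fun u => ?_⟩
    simp only [Pi.smul_apply, smul_eq_mul, enorm_mul, ENNReal.tsum_mul_left]
    push_cast
    exact mul_le_mul' le_rfl (hC u)

lemma tsum_mul_sq_le {I : Type*} (a b : I → ℝ≥0∞) :
    (∑' i, a i * b i) ^ 2 ≤ (∑' i, a i) * ∑' i, a i * b i ^ 2 := by
  let _ : MeasurableSpace I := ⊤
  have h := ENNReal.lintegral_mul_le_Lp_mul_Lq (MeasureTheory.Measure.count : MeasureTheory.Measure I)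
    Real.HolderConjugate.two_two (f := fun i => a i ^ (1 / 2 : ℝ))
    (g := fun i => a i ^ (1 / 2 : ℝ) * b i) (measurable_from_top.aemeasurable)
    (measurable_from_top.aemeasurable)
  simp only [MeasureTheory.lintegral_count, Pi.mul_apply, ← mul_assoc] at h
  have e1 : ∀ x : ℝ≥0∞, x ^ (1 / 2 : ℝ) * x ^ (1 / 2 : ℝ) = x := fun x => by
    rw [← ENNReal.rpow_add_of_nonneg _ _ (by norm_num) (by norm_num)]; norm_num
  have e2 : ∀ x : ℝ≥0∞, (x ^ (1 / 2 : ℝ)) ^ (2 : ℝ) = x := fun x => by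
    rw [← ENNReal.rpow_mul]; norm_num
  simp only [ENNReal.mul_rpow_of_nonneg _ _ (show (0 : ℝ) ≤ 2 by norm_num), e1, e2,
    ENNReal.rpow_two] at h
  calc _ ≤ _ := pow_le_pow_left' h 2
    _ = _ := by
      rw [← ENNReal.mul_rpow_of_nonneg _ _ (by norm_num : (0 : ℝ) ≤ 1 / 2), ← ENNReal.rpow_two, e2]

/-- The Schur test. -/
lemma schur {I : Type*} {a : I → I → ℂ} {C : ℝ≥0} (hrow : ∀ i, ∑' j, ‖a i j‖ₑ ≤ C)
    (hcol : ∀ j, ∑' i, ‖a i j‖ₑ ≤ C) (ξ : I → ℂ) :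
    ∑' i, ‖∑' j, a i j * ξ j‖ₑ ^ 2 ≤ (C : ℝ≥0∞) ^ 2 * ∑' j, ‖ξ j‖ₑ ^ 2 := by
  calc ∑' i, ‖∑' j, a i j * ξ j‖ₑ ^ 2
      ≤ ∑' i, (C : ℝ≥0∞) * ∑' j, ‖a i j‖ₑ * ‖ξ j‖ₑ ^ 2 := by
        refine ENNReal.tsum_le_tsum fun i => ?_
        calc _ ≤ (∑' j, ‖a i j‖ₑ * ‖ξ j‖ₑ) ^ 2 := by
              refine pow_le_pow_left' ?_ 2
              simp only [← enorm_mul]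
              exact enorm_tsum_le_tsum_enorm
          _ ≤ _ := tsum_mul_sq_le _ _
          _ ≤ _ := mul_le_mul' (hrow i) le_rfl
    _ = (C : ℝ≥0∞) * ∑' j, (∑' i, ‖a i j‖ₑ) * ‖ξ j‖ₑ ^ 2 := by
        rw [ENNReal.tsum_mul_left, ENNReal.tsum_comm]
        simp only [ENNReal.tsum_mul_right]
    _ ≤ (C : ℝ≥0∞) * ∑' j, (C : ℝ≥0∞) * ‖ξ j‖ₑ ^ 2 :=
        mul_le_mul' le_rfl (ENNReal.tsum_le_tsum fun j => mul_le_mul' (hcol j) le_rfl)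
    _ = _ := by rw [ENNReal.tsum_mul_left, sq, mul_assoc]

lemma enorm_sq_eq {I : Type*} (ξ : Ell2 I) : ∑' i, ‖ξ i‖ₑ ^ 2 = ENNReal.ofReal (‖ξ‖ ^ 2) := by
  have h := lp.hasSum_norm (p := 2) (by norm_num) ξ
  simp only [ENNReal.toReal_ofNat, Real.rpow_two] at h
  rw [← h.tsum_eq, ENNReal.ofReal_tsum_of_nonneg (fun _ => by positivity) h.summable]
  refine tsum_congr fun i => ?_
  rw [ENNReal.ofReal_pow (norm_nonneg _), ofReal_norm]

lemma memℓp_two {I : Type*} {ξ : I → ℂ} (h : ∑' i, ‖ξ i‖ₑ ^ 2 ≠ ∞) : Memℓp ξ 2 := by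
  rw [memℓp_gen_iff (by norm_num)]
  simp only [ENNReal.toReal_ofNat, Real.rpow_two]
  have := ENNReal.summable_toReal h
  simpa using this

lemma summable_row {I : Type*} {a : I → I → ℂ} {C : ℝ≥0} (hrow : ∀ i, ∑' j, ‖a i j‖ₑ ≤ C)
    (ξ : Ell2 I) (i : I) : Summable fun j => a i j * ξ j := by
  have h1 : Summable fun j => ‖a i j‖ := by
    have := ENNReal.summable_toReal (ne_top_of_le_ne_top ENNReal.coe_ne_top (hrow i))
    simpa using this
  refine Summable.of_norm_bounded (h1.mul_right ‖ξ‖) fun j => ?_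
  rw [norm_mul]
  exact mul_le_mul_of_nonneg_left (lp.norm_apply_le_norm (by norm_num) ξ j) (norm_nonneg _)

section

variable {G : Type*} [ArrowGroupoid G] {x : UnitSpace G}

/-- For `g ∈ G_x`, the map `h ↦ h⁻¹ g` is a bijection of `G^{r(g)}` onto `G_x`, with inverse
`k ↦ g k⁻¹`. -/
def invMulEquiv (g : SrcFiber x) : RngFiber (rng (g : G)) ≃ SrcFiber x where
  toFun h := invMul g h
  invFun k := ⟨g * (k : G)⁻¹, by rw [rng_mul _ _ (by rw [rng_inv, g.2, k.2])]⟩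
  left_inv := by
    rintro ⟨h, hh⟩
    refine Subtype.ext ?_
    have e1 : src h⁻¹ = rng (g : G) := by rw [src_inv, hh]
    change (g : G) * (h⁻¹ * g)⁻¹ = h
    set k := h⁻¹ * (g : G) with hk
    have hks : src k = src (g : G) := src_mul _ _ e1
    have hkr : rng k = src h := by rw [hk, rng_mul _ _ e1, rng_inv]
    have e2 : h * k = g := by
      rw [hk, ← mul_assoc' _ _ _ (by rw [rng_inv]) e1, mul_inv_self, hh, rng_mul_self]
    have e3 : (g : G) * k⁻¹ = h * k * k⁻¹ := by rw [e2]
    rw [e3, mul_assoc' _ _ _ hkr.symm (by rw [rng_inv]), mul_inv_self, hkr, mul_src]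
  right_inv := by
    rintro ⟨k, hk⟩
    refine Subtype.ext ?_
    have e1 : src (g : G) = rng k⁻¹ := by rw [rng_inv, g.2, hk]
    change ((g : G) * k⁻¹)⁻¹ * g = k
    set m := (g : G) * k⁻¹ with hm
    have hms : src m = rng k := by rw [hm, src_mul _ _ e1, src_inv]
    have e2 : m * k = g := by
      rw [hm, mul_assoc' _ _ _ e1 (by rw [src_inv]), inv_mul_self, hk.trans g.2.symm, mul_src]
    have e3 : m⁻¹ * (g : G) = m⁻¹ * (m * k) := by rw [e2]
    rw [e3, ← mul_assoc' _ _ _ (by rw [src_inv]) hms, inv_mul_self, hms, rng_mul_self]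

/-- The matrix of `ρ_x(f)` in the standard basis. -/
def kernel (f : G → ℂ) (g k : SrcFiber x) : ℂ := f (g * (k : G)⁻¹)

lemma tsum_eq (f : G → ℂ) (ξ : SrcFiber x → ℂ) (g : SrcFiber x) :
    ∑' h : RngFiber (rng (g : G)), f h * ξ (invMul g h) = ∑' k, kernel f g k * ξ k := by
  rw [← (invMulEquiv g).symm.tsum_eq]
  refine tsum_congr fun k => ?_
  have : invMul g ((invMulEquiv g).symm k) = k := (invMulEquiv g).apply_symm_apply k
  rw [this]
  rfl

lemma kernel_row {f : G → ℂ} {C : ℝ≥0} (hC : FiberBdd (rng : G → G) f C) (g : SrcFiber x) :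
    ∑' k, ‖kernel f g k‖ₑ ≤ C := by
  refine le_trans (le_of_eq ?_) (hC (rng (g : G)))
  rw [← (invMulEquiv g).symm.tsum_eq]
  rfl

lemma kernel_col {f : G → ℂ} {C : ℝ≥0} (hC : FiberBdd (src : G → G) f C) (k : SrcFiber x) :
    ∑' g, ‖kernel f g k‖ₑ ≤ C := by
  have e : ∀ g : SrcFiber x, src (g : G) = rng (k : G)⁻¹ := fun g => by rw [rng_inv, g.2, k.2]
  let φ : SrcFiber x → {h : G // src h = rng (k : G)} := fun g =>
    ⟨g * (k : G)⁻¹, by rw [src_mul _ _ (e g), src_inv]⟩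
  have hφ : Function.Injective φ := by
    intro g g' hgg
    have h1 : (g : G) * (k : G)⁻¹ = g' * (k : G)⁻¹ := congrArg Subtype.val hgg
    have h2 : ∀ g : SrcFiber x, (g : G) * (k : G)⁻¹ * k = g := fun g => by
      rw [mul_assoc' _ _ _ (e g) (by rw [src_inv]), inv_mul_self, k.2.trans g.2.symm, mul_src]
    exact Subtype.ext (by rw [← h2 g, h1, h2 g'])
  exact (ENNReal.tsum_comp_le_tsum_of_injective hφ (fun h => ‖f h‖ₑ)).trans (hC _)

end

lemma exists_bound {G : Type*} [TopologicalSpace G] [EtaleGroupoid G] (f : Cc G) :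
    ∃ C, FiberBdd (src : G → G) f C ∧ FiberBdd (rng : G → G) f C := by
  obtain ⟨C, hC⟩ := exists_fiberBdd (φ := (src : G → G)) (fun g => by
    obtain ⟨W, hW, hg, hi⟩ :=
      (EtaleGroupoid.isLocalHomeomorph_src (G := G)).isLocallyInjective g
    exact ⟨W, hW, hg, fun a ha b hb hab => hi ha hb (Subtype.ext hab)⟩) f.2
  obtain ⟨D, hD⟩ := exists_fiberBdd (φ := (rng : G → G)) (fun g => by
    obtain ⟨W, hW, hg, hi⟩ :=
      (EtaleGroupoid.isLocalHomeomorph_rng (G := G)).isLocallyInjective g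
    exact ⟨W, hW, hg, fun a ha b hb hab => hi ha hb (Subtype.ext hab)⟩) f.2
  exact ⟨max C D, fun u => (hC u).trans (by exact_mod_cast le_max_left C D),
    fun u => (hD u).trans (by exact_mod_cast le_max_right C D)⟩

end RegBound

/-- The C⋆-subalgebra generated by a subset of a C⋆-algebra. -/
def generatedCStar {B : Type*} [NonUnitalCStarAlgebra B] (S : Set B) :
    NonUnitalStarSubalgebra ℂ B :=
  (NonUnitalStarAlgebra.adjoin ℂ S).topologicalClosure

lemma isClosed_generatedCStar {B : Type*} [NonUnitalCStarAlgebra B] (S : Set B) :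
    IsClosed (generatedCStar S : Set B) :=
  NonUnitalStarSubalgebra.isClosed_topologicalClosure _

/-! ### The regular representations and the reduced C⋆-algebra -/

section Reduced

variable {G : Type*} [TopologicalSpace G] [EtaleGroupoid G]

/-- The function `ρ_x(f) ξ` on `G_x`, given by
`(ρ_x(f) ξ)(g) = ∑_{h ∈ G^{r(g)}} f(h) ξ(h⁻¹ g)`; for `f ∈ C_c(G)` only finitely many summands are
nonzero. -/
def regFun (f : Cc G) (x : UnitSpace G) (ξ : SrcFiber x → ℂ) (g : SrcFiber x) : ℂ :=
  ∑' h : RngFiber (rng (g : G)), (f : G → ℂ) h * ξ (invMul g h)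

lemma regFun_bound {f : Cc G} {C : ℝ≥0}
    (hC : RegBound.FiberBdd (src : G → G) f C ∧ RegBound.FiberBdd (rng : G → G) f C)
    (x : UnitSpace G) (ξ : Ell2 (SrcFiber x)) :
    ∑' g, ‖regFun f x ξ g‖ₑ ^ 2 ≤ ENNReal.ofReal ((C * ‖ξ‖) ^ 2) := by
  have h := RegBound.schur (fun g => RegBound.kernel_row (x := x) hC.2 g)
    (RegBound.kernel_col hC.1) ξ
  rw [RegBound.enorm_sq_eq] at h
  simp only [regFun, RegBound.tsum_eq]
  refine h.trans (le_of_eq ?_)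
  rw [mul_pow, ENNReal.ofReal_mul (by positivity), ENNReal.ofReal_pow C.coe_nonneg,
    ENNReal.ofReal_coe_nnreal]

lemma memℓp_regFun (f : Cc G) (x : UnitSpace G) (ξ : Ell2 (SrcFiber x)) :
    Memℓp (regFun f x ξ) 2 := by
  obtain ⟨C, hC⟩ := RegBound.exists_bound f
  exact RegBound.memℓp_two (ne_top_of_le_ne_top ENNReal.ofReal_ne_top (regFun_bound hC x ξ))

lemma regFun_norm_le {f : Cc G} {C : ℝ≥0}
    (hC : RegBound.FiberBdd (src : G → G) f C ∧ RegBound.FiberBdd (rng : G → G) f C)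
    (x : UnitSpace G) (ξ : Ell2 (SrcFiber x)) :
    ‖(⟨regFun f x ξ, memℓp_regFun f x ξ⟩ : Ell2 (SrcFiber x))‖ ≤ C * ‖ξ‖ := by
  have h := regFun_bound hC x ξ
  have h2 := RegBound.enorm_sq_eq (⟨regFun f x ξ, memℓp_regFun f x ξ⟩ : Ell2 (SrcFiber x))
  rw [← abs_of_nonneg (show (0 : ℝ) ≤ C * ‖ξ‖ by positivity)]
  refine (abs_le_of_sq_le_sq' ?_ (by positivity)).2
  rw [sq_abs]
  refine (ENNReal.ofReal_le_ofReal_iff (by positivity)).1 ?_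
  rw [← h2]
  exact h

/-- The bounded operator `ρ_x(f)` on `ℓ²(G_x)`. -/
def regOp (f : Cc G) (x : UnitSpace G) : Ell2 (SrcFiber x) →L[ℂ] Ell2 (SrcFiber x) :=
  LinearMap.mkContinuousOfExistsBound
    { toFun := fun ξ => ⟨regFun f x ξ, memℓp_regFun f x ξ⟩
      map_add' := fun ξ η => by
        obtain ⟨C, hC⟩ := RegBound.exists_bound f
        refine lp.ext (funext fun g => ?_)
        change regFun f x (fun k => ξ k + η k) g = regFun f x ξ g + regFun f x η g
        simp only [regFun]
        rw [RegBound.tsum_eq _ (fun k => ξ k + η k), RegBound.tsum_eq _ ξ, RegBound.tsum_eq _ η]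
        simp only [mul_add]
        exact Summable.tsum_add (RegBound.summable_row (RegBound.kernel_row hC.2) ξ g)
          (RegBound.summable_row (RegBound.kernel_row hC.2) η g)
      map_smul' := fun c ξ => by
        refine lp.ext (funext fun g => ?_)
        simp only [lp.coeFn_smul, Pi.smul_apply, regFun, smul_eq_mul, RingHom.id_apply,
          mul_left_comm _ c]
        exact tsum_mul_left }
    (by
      obtain ⟨C, hC⟩ := RegBound.exists_bound f
      exact ⟨C, regFun_norm_le hC x⟩)

lemma memℓp_regOp (f : Cc G) : Memℓp (fun x : UnitSpace G => regOp f x) ∞ := by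
  obtain ⟨C, hC⟩ := RegBound.exists_bound f
  refine memℓp_infty ⟨C, ?_⟩
  rintro _ ⟨x, rfl⟩
  exact ContinuousLinearMap.opNorm_le_bound _ C.2 (regFun_norm_le hC x)

variable (G) in
/-- The C⋆-algebra `∏_x B(ℓ²(G_x))` of bounded families of operators, with the supremum norm. -/
def FiberOps : Type _ :=
  lp (fun x : UnitSpace G => Ell2 (SrcFiber x) →L[ℂ] Ell2 (SrcFiber x)) ∞

instance : NonUnitalCStarAlgebra (FiberOps G) :=
  inferInstanceAs (NonUnitalCStarAlgebra
    (lp (fun x : UnitSpace G => Ell2 (SrcFiber x) →L[ℂ] Ell2 (SrcFiber x)) ∞))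

/-- The coordinate projection `∏_z B(ℓ²(G_z)) → B(ℓ²(G_x))`. -/
def FiberOps.eval (x : UnitSpace G) :
    FiberOps G →⋆ₙₐ[ℂ] (Ell2 (SrcFiber x) →L[ℂ] Ell2 (SrcFiber x)) where
  toFun a := a.1 x
  map_smul' _ _ := rfl
  map_zero' := rfl
  map_add' _ _ := rfl
  map_mul' _ _ := rfl
  map_star' _ := rfl

/-- The family `(ρ_x(f))_x`.  Its norm is the reduced norm `‖f‖_r = sup_x ‖ρ_x(f)‖`. -/
def regFamily (f : Cc G) : FiberOps G := ⟨fun x => regOp f x, memℓp_regOp f⟩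

variable (G) in
/-- The reduced C⋆-algebra `C⋆_r(G)`, realised as the C⋆-algebra generated by the families
`(ρ_x(f))_x`, `f ∈ C_c(G)`, in `∏_x B(ℓ²(G_x))`.  (As `C_c(G)` is a ⋆-algebra under convolution and
the `ρ_x` are ⋆-representations, this is the closure of the image of `C_c(G)`, that is, the
completion of `C_c(G)` in the reduced norm.) -/
def ReducedCStar : NonUnitalStarSubalgebra ℂ (FiberOps G) :=
  generatedCStar (Set.range (regFamily : Cc G → FiberOps G))

instance : IsClosed (ReducedCStar G : Set (FiberOps G)) := isClosed_generatedCStar _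

instance : NonUnitalCStarAlgebra (ReducedCStar G) :=
  NonUnitalStarSubalgebra.nonUnitalCStarAlgebra _

/-- The representation `ρ_x` of `C⋆_r(G)` on `ℓ²(G_x)`. -/
def regRep (x : UnitSpace G) :
    ReducedCStar G →⋆ₙₐ[ℂ] (Ell2 (SrcFiber x) →L[ℂ] Ell2 (SrcFiber x)) :=
  (FiberOps.eval x).comp (NonUnitalStarSubalgebraClass.subtype (ReducedCStar G))

end Reduced

/-! ### Direct sums and weak containment of representations -/

section Representations

variable {A : Type*} [NonUnitalCStarAlgebra A]

/-- The Hilbert space direct sum `⊕_i σ_i` of a family of representations of a C⋆-algebra. -/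
def directSumRep {ι : Type*} {H : ι → Type*} [∀ i, NormedAddCommGroup (H i)]
    [∀ i, InnerProductSpace ℂ (H i)] [∀ i, CompleteSpace (H i)]
    (σ : ∀ i, A →⋆ₙₐ[ℂ] (H i →L[ℂ] H i)) : A →⋆ₙₐ[ℂ] (lp H 2 →L[ℂ] lp H 2) where
  toFun a := lp.mapCLM 2 (fun i => σ i a) (norm_nonneg a)
    (fun i => NonUnitalStarAlgHom.norm_apply_le (σ i) a)
  map_smul' c a := by ext ξ i; simp
  map_zero' := by ext ξ i; simp
  map_add' a b := by ext ξ i; simp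
  map_mul' a b := by ext ξ i; simp
  map_star' a := by
    rw [ContinuousLinearMap.star_eq_adjoint, ContinuousLinearMap.eq_adjoint_iff]
    intro ξ η
    simp only [lp.inner_eq_tsum]
    refine tsum_congr fun i => ?_
    simp [map_star, ContinuousLinearMap.star_eq_adjoint, ContinuousLinearMap.adjoint_inner_left]

/-- A representation `π` of a C⋆-algebra is weakly contained in `σ` if `ker σ ⊆ ker π`
(equivalently, if `‖π(a)‖ ≤ ‖σ(a)‖` for all `a`). -/
def WeaklyContained {H K : Type*} [NormedAddCommGroup H] [InnerProductSpace ℂ H] [CompleteSpace H]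
    [NormedAddCommGroup K] [InnerProductSpace ℂ K] [CompleteSpace K]
    (π : A →⋆ₙₐ[ℂ] (H →L[ℂ] H)) (σ : A →⋆ₙₐ[ℂ] (K →L[ℂ] K)) : Prop :=
  ∀ a : A, σ a = 0 → π a = 0

end Representations

end

open ArrowGroupoid

/-!
The source map is injective on `U k ∋ g k`, so the units `y ∈ U k` converge to `g k` as they
approach `x` in the unit space, hence also to each power of `g k`.  Let `v k` be the average of
bump functions around `1, g k, …, g k ^ (N k - 1)`, where `N k` is the order of `g k`, or a large
number if the order is infinite.  For `y ∈ U k` near `x`, the restriction of `v k` to `r⁻¹(y)` is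
then the point mass at `y`, so `v k` acts as the identity on the coordinates with range `y`.  For a
bump function `f` on the units near `x`, invariance of `Y` gives
`ρ_y(f)⋆ ρ_y(f) ≤ ∑ k, ρ_y(v k)⋆ ρ_y(v k)` for all `y ∈ Y`.  Weak containment transfers this
inequality to `ρ_x`, as it kills the negative part of the difference.  At the basis vector `δ_x` it
yields `1 ≤ ∑ k, 1 / N k`, while the orders allow `N` to be chosen with `∑ k, 1 / N k < 1`.
-/

section OneDiv

open Filter

lemma exists_pos_injOn_pow_sum_lt {ι Γ : Type*} [Fintype ι] [Group Γ] (g : ι → Γ) {r : ℝ}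
    (hord : ∑ k, 1 / (orderOf (g k) : ℝ) < r) :
    ∃ N : ι → ℕ, (∀ k, 0 < N k) ∧ (∀ k, InjOn (g k ^ ·) (Iio (N k))) ∧
      ∑ k, 1 / (N k : ℝ) < r := by
  let N (m : ℕ) (k : ι) : ℕ := if orderOf (g k) = 0 then m else orderOf (g k)
  have tendsto_one_div (k : ι) :
      Tendsto (fun m => 1 / (N m k : ℝ)) atTop (𝓝 (1 / (orderOf (g k) : ℝ))) := by
    by_cases h : orderOf (g k) = 0
    · simpa [N, h] using tendsto_one_div_atTop_nhds_zero_nat (𝕜 := ℝ)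
    · simp [N, h]
  obtain ⟨m, hsum, hm⟩ :=
    (((tendsto_finsetSum _ fun k _ => tendsto_one_div k).eventually_lt_const hord).and
      (eventually_gt_atTop 0)).exists
  refine ⟨N m, fun k => ?_, fun k => ?_, hsum⟩ <;> by_cases h : orderOf (g k) = 0
  · simpa [N, h] using hm
  · simpa [N, h] using Nat.pos_of_ne_zero h
  · exact (injective_pow_iff_not_isOfFinOrder.2 (orderOf_eq_zero_iff.1 h)).injOn
  · simpa [N, h] using pow_injOn_Iio_orderOf

end OneDiv

lemma lp_hasSum_norm_sq {ι : Type*} {H : ι → Type*} [∀ i, NormedAddCommGroup (H i)]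
    (ξ : lp H 2) : HasSum (fun i => ‖ξ i‖ ^ 2) (‖ξ‖ ^ 2) := by
  simpa using lp.hasSum_norm (p := 2) (by norm_num) ξ

lemma norm_sq_smul_sum_single {ι I : Type*} [Fintype ι] [DecidableEq I] {p : ι → I}
    (hp : Function.Injective p) (c : ℂ) :
    ‖c • ∑ j, (lp.single 2 (p j) 1 : Ell2 I)‖ ^ 2 = Fintype.card ι * ‖c‖ ^ 2 := by
  have h := lp.norm_sum_single (E := fun _ : I => ℂ) (p := 2) (by norm_num) (fun _ => 1)
    (Finset.univ.map ⟨p, hp⟩)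
  simp only [Finset.sum_map, Function.Embedding.coeFn_mk, ENNReal.toReal_ofNat, Real.rpow_two,
    norm_one, one_pow, Finset.sum_const, Finset.card_map, Finset.card_univ, nsmul_eq_mul,
    mul_one] at h
  rw [norm_smul, mul_pow, h, mul_comm]

section WeakContainment

variable {A : Type*} [NonUnitalCStarAlgebra A]

lemma starAlgHom_map_negPart {B : Type*} [NonUnitalCStarAlgebra B] (π : A →⋆ₙₐ[ℂ] B) {a : A}
    (ha : IsSelfAdjoint a) : π a⁻ = (π a)⁻ := by
  rw [CFC.negPart_def, CFC.negPart_def]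
  exact π.map_cfcₙ _ a
    (hφ := AddMonoidHomClass.continuous_of_bound π 1 fun c => by
      simpa using NonUnitalStarAlgHom.norm_apply_le π c) (ha := ha) (hφa := ha.map π)

variable {H K : Type*} [NormedAddCommGroup H] [InnerProductSpace ℂ H] [CompleteSpace H]
  [NormedAddCommGroup K] [InnerProductSpace ℂ K] [CompleteSpace K] {ι : Type*} [Fintype ι]

lemma star_mul_self_le_sum_iff {S : H →L[ℂ] H} {T : ι → H →L[ℂ] H} :
    star S * S ≤ ∑ k, star (T k) * T k ↔ ∀ ξ, ‖S ξ‖ ^ 2 ≤ ∑ k, ‖T k ξ‖ ^ 2 := by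
  have inner_star_mul_self (R : H →L[ℂ] H) (ξ : H) :
      inner ℂ ((star R * R) ξ) ξ = ((‖R ξ‖ ^ 2 : ℝ) : ℂ) := by
    rw [ContinuousLinearMap.star_eq_adjoint, mul_apply_eq_comp,
      ContinuousLinearMap.adjoint_inner_left, inner_self_eq_norm_sq_to_K]
    simp
  rw [ContinuousLinearMap.le_def, ContinuousLinearMap.isPositive_iff_complex]
  simp only [sub_apply, sum_apply, inner_sub_left, sum_inner, inner_star_mul_self,
    ← Complex.ofReal_sum, ← Complex.ofReal_sub, RCLike.re_to_complex, Complex.ofReal_re, true_and,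
    sub_nonneg]

variable {π : A →⋆ₙₐ[ℂ] (H →L[ℂ] H)} {σ : A →⋆ₙₐ[ℂ] (K →L[ℂ] K)}

lemma WeaklyContained.map_nonneg (h : WeaklyContained π σ) {a : A} (ha : IsSelfAdjoint a)
    (hσ : 0 ≤ σ a) : 0 ≤ π a := by
  rw [← CFC.negPart_eq_zero_iff _ (ha.map π), ← starAlgHom_map_negPart π ha]
  apply h
  rwa [starAlgHom_map_negPart σ ha, CFC.negPart_eq_zero_iff _ (ha.map σ)]

lemma WeaklyContained.norm_sq_le_sum (h : WeaklyContained π σ) {a : A} {b : ι → A}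
    (hσ : ∀ η, ‖σ a η‖ ^ 2 ≤ ∑ k, ‖σ (b k) η‖ ^ 2) (ξ : H) :
    ‖π a ξ‖ ^ 2 ≤ ∑ k, ‖π (b k) ξ‖ ^ 2 := by
  have hsa : IsSelfAdjoint (∑ k, star (b k) * b k - star a * a) := by
    simp [IsSelfAdjoint, star_sum]
  have hπ : 0 ≤ π (∑ k, star (b k) * b k - star a * a) := by
    refine h.map_nonneg hsa ?_
    simpa only [map_sub, map_sum, map_mul, map_star, sub_nonneg] using
      star_mul_self_le_sum_iff.2 hσ
  simp only [map_sub, map_sum, map_mul, map_star, sub_nonneg] at hπ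
  exact star_mul_self_le_sum_iff.1 hπ ξ

variable {J : Type*} {L : J → Type*} [∀ j, NormedAddCommGroup (L j)]
  [∀ j, InnerProductSpace ℂ (L j)] [∀ j, CompleteSpace (L j)]

lemma hasSum_norm_sq_directSumRep
    (τ : ∀ j, A →⋆ₙₐ[ℂ] (L j →L[ℂ] L j)) (a : A) (η : lp L 2) :
    HasSum (fun j => ‖τ j a (η j)‖ ^ 2) (‖directSumRep τ a η‖ ^ 2) :=
  lp_hasSum_norm_sq (directSumRep τ a η)

lemma norm_sq_directSumRep_le_sum {τ : ∀ j, A →⋆ₙₐ[ℂ] (L j →L[ℂ] L j)} {a : A}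
    {b : ι → A} (h : ∀ j ξ, ‖τ j a ξ‖ ^ 2 ≤ ∑ k, ‖τ j (b k) ξ‖ ^ 2) (η : lp L 2) :
    ‖directSumRep τ a η‖ ^ 2 ≤ ∑ k, ‖directSumRep τ (b k) η‖ ^ 2 :=
  hasSum_le (fun j => h j (η j)) (hasSum_norm_sq_directSumRep τ a η)
    (hasSum_sum fun k _ => hasSum_norm_sq_directSumRep τ (b k) η)

end WeakContainment

section Topology

variable {X : Type*} [TopologicalSpace X]

lemma comap_nhds_inf_principal_le_nhds {Z : Type*} [TopologicalSpace Z] {f : X → Z}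
    (hf : IsOpenMap f) {V : Set X} (hV : IsOpen V) (hinj : InjOn f V) {a : X} (ha : a ∈ V) :
    Filter.comap f (𝓝 (f a)) ⊓ Filter.principal V ≤ 𝓝 a := by
  intro O hO
  have image_mem : f '' (O ∩ V) ∈ 𝓝 (f a) :=
    hf.image_mem_nhds (Filter.inter_mem hO (hV.mem_nhds ha))
  refine Filter.mem_inf_principal.2 ⟨_, image_mem, ?_⟩
  rintro b ⟨c, ⟨hcO, hcV⟩, hcb⟩ hbV
  rwa [← hinj hcV hbV hcb]

lemma extend_mem_Cc {O : Set X} [T2Space O] (hO : IsOpen O) {F : O → ℂ} (hF : Continuous F)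
    (hFc : HasCompactSupport F) : Function.extend Subtype.val F 0 ∈ Cc X := by
  have extend_apply (h : O) : Function.extend Subtype.val F 0 (h : X) = F h :=
    Subtype.val_injective.extend_apply F 0 h
  refine Submodule.subset_span ⟨O, hO, inferInstance, ?_, Subtype.val '' tsupport F,
    Subtype.coe_image_subset _ _, hFc.image continuous_subtype_val, fun g hg => ?_⟩
  · rw [continuousOn_iff_continuous_domRestrict]
    exact hF.congr fun h => (extend_apply h).symm
  · by_cases hgO : g ∈ O
    · rw [extend_apply ⟨g, hgO⟩]
      exact image_eq_zero_of_notMem_tsupport fun h => hg ⟨_, h, rfl⟩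
    · rw [Function.extend_apply' _ _ _ (by simpa using hgO), Pi.zero_apply]

lemma exists_mem_Cc_eventually_eq_one [LocallyCompactSpace X] {O : Set X} [T2Space O]
    (hO : IsOpen O) {g : X} (hg : g ∈ O) :
    ∃ b ∈ Cc X, (∀ h ∉ O, b h = 0) ∧ (∀ h, ‖b h‖ ≤ 1) ∧ ∀ᶠ h in 𝓝 g, b h = 1 := by
  have : LocallyCompactSpace O := hO.locallyCompactSpace
  obtain ⟨K, hK, hKg⟩ := exists_compact_mem_nhds (⟨g, hg⟩ : O)
  obtain ⟨F, hF_one, -, hF_supp, hF_mem⟩ :=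
    exists_continuous_one_zero_of_isCompact hK isClosed_empty (disjoint_empty K)
  let b : X → ℂ := Function.extend Subtype.val (fun h : O => (F h : ℂ)) 0
  have b_of_mem (h : O) : b h = F h :=
    Subtype.val_injective.extend_apply (fun h : O => (F h : ℂ)) 0 h
  have b_of_notMem (h : X) (hh : h ∉ O) : b h = 0 :=
    Function.extend_apply' _ _ _ (by simpa using hh)
  refine ⟨b, extend_mem_Cc hO (by fun_prop) (hF_supp.comp_left Complex.ofReal_zero), b_of_notMem,
    fun h => ?_, ?_⟩
  · by_cases hh : h ∈ O
    · rw [b_of_mem ⟨h, hh⟩, Complex.norm_of_nonneg (hF_mem _).1]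
      exact (hF_mem _).2
    · simp [b_of_notMem h hh]
  · rw [← hO.isOpenEmbedding_subtypeVal.map_nhds_eq ⟨g, hg⟩, Filter.eventually_map]
    filter_upwards [hKg] with h hh
    rw [b_of_mem, hF_one hh, Pi.one_apply, Complex.ofReal_one]

end Topology

namespace ArrowGroupoid

variable {G : Type*} [ArrowGroupoid G]

lemma srcMap_unit (z : UnitSpace G) : srcMap (z : G) = z :=
  Subtype.ext z.2

lemma unit_mul_self (z : UnitSpace G) : (z : G) * z = z := by
  simpa only [z.2] using mul_src (z : G)

lemma inv_unit (z : UnitSpace G) : (z : G)⁻¹ = z := by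
  have mul_eq_inv : (z : G)⁻¹ * z = (z : G)⁻¹ := by
    simpa only [src_inv, rng_unit] using mul_src (z : G)⁻¹
  rw [← mul_eq_inv, inv_mul_self, z.2]

lemma invMul_rng {x : UnitSpace G} (g : SrcFiber x) : invMul g ⟨rng (g : G), rng_rng _⟩ = g :=
  Subtype.ext <| (congrArg (· * (g : G)) (inv_unit (rngMap (g : G)))).trans (rng_mul_self _)

lemma mul_inv_unit {x : UnitSpace G} (g : SrcFiber x) : (g : G) * (x : G)⁻¹ = g := by
  simpa only [inv_unit, g.2] using mul_src (g : G)

lemma IsInvariant.rngMap_mem {Y : Set (UnitSpace G)} (hY : IsInvariant Y) {y : UnitSpace G}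
    (hy : y ∈ Y) (g : SrcFiber y) : rngMap (g : G) ∈ Y :=
  (hY g).1 (by rwa [show srcMap (g : G) = y from Subtype.ext g.2])

/-- The restriction of `v` to the range fibre `G^u` is the point mass at the unit `u`.  This makes
`(ρ_y(v) ξ)(g) = ξ(g)` whenever `r(g) = u`. -/
def IsPointMassAt (v : G → ℂ) (u : UnitSpace G) : Prop :=
  v u = 1 ∧ ∀ h : G, rng h = u → h ≠ u → v h = 0

lemma isPointMassAt_smul_sum {ι : Type*} [Fintype ι] {b : ι → G → ℂ} {u : UnitSpace G}
    (hb : ∀ j, IsPointMassAt (b j) u) {c : ℂ} (hc : c * Fintype.card ι = 1) :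
    IsPointMassAt (c • ∑ j, b j) u := by
  refine ⟨?_, fun h hr hne => ?_⟩
  · simpa [(hb _).1] using hc
  · simp [(hb _).2 h hr hne]

end ArrowGroupoid

section Etale

variable {G : Type*} [TopologicalSpace G] [EtaleGroupoid G]

lemma continuous_srcMap : Continuous (srcMap : G → UnitSpace G) :=
  EtaleGroupoid.isLocalHomeomorph_src.continuous

lemma exists_isOpenBisection (g : G) : ∃ B : Set G, IsOpenBisection B ∧ g ∈ B := by
  obtain ⟨V, hV, hgV, hiV⟩ := (EtaleGroupoid.isLocalHomeomorph_src (G := G)).isLocallyInjective g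
  obtain ⟨W, hW, hgW, hiW⟩ := (EtaleGroupoid.isLocalHomeomorph_rng (G := G)).isLocallyInjective g
  exact ⟨V ∩ W, ⟨hV.inter hW, fun a ha b hb h => hiV ha.1 hb.1 (Subtype.ext h),
    fun a ha b hb h => hiW ha.2 hb.2 (Subtype.ext h)⟩, hgV, hgW⟩

lemma IsOpenBisection.mono {B B' : Set G} (hB : IsOpenBisection B) (hB' : IsOpen B')
    (h : B' ⊆ B) : IsOpenBisection B' :=
  ⟨hB', hB.2.1.mono h, hB.2.2.mono h⟩

lemma t2Space_of_injOn_src {B : Set G} (hB : InjOn src B) : T2Space B := by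
  have := EtaleGroupoid.t2_units (G := G)
  refine T2Space.of_injective_continuous (f := fun b : B => srcMap (b : G)) (fun a b h => ?_)
    (continuous_srcMap.comp continuous_subtype_val)
  exact Subtype.ext (hB a.2 b.2 (congrArg Subtype.val h))

lemma eventually_src_eq_self (x : UnitSpace G) : ∀ᶠ g : G in 𝓝 x, src g = g := by
  obtain ⟨B, hB, hx⟩ := exists_isOpenBisection (x : G)
  have tendsto_src : Filter.Tendsto (src : G → G) (𝓝 x) (𝓝 x) := by
    have h := (continuous_subtype_val.comp (continuous_srcMap (G := G))).tendsto (x : G)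
    rwa [Function.comp_apply, srcMap_unit] at h
  have hBx : B ∈ 𝓝 (x : G) := hB.1.mem_nhds hx
  filter_upwards [hBx, tendsto_src hBx] with g hg hsg
  exact hB.2.1 hsg hg (src_src g)

lemma tendsto_units_isotropy {x : UnitSpace G} (γ : Isotropy x) {V : Set G} (hV : IsOpen V)
    (hinj : InjOn src V) (hγ : γ.1 ∈ V) :
    Filter.Tendsto (Subtype.val : UnitSpace G → G) (𝓝[Subtype.val ⁻¹' V] x) (𝓝 γ.1) := by
  have tendsto_src : Filter.Tendsto (srcMap ∘ (Subtype.val : UnitSpace G → G))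
      (𝓝[Subtype.val ⁻¹' V] x) (𝓝 (srcMap γ.1)) := by
    rw [show srcMap γ.1 = x from Subtype.ext γ.2.1,
      show srcMap ∘ (Subtype.val : UnitSpace G → G) = id from funext srcMap_unit]
    exact nhdsWithin_le_nhds
  have injOn_srcMap : InjOn (srcMap : G → UnitSpace G) V := fun a ha b hb h =>
    hinj ha hb (congrArg Subtype.val h)
  refine (Filter.tendsto_inf.2 ⟨Filter.tendsto_comap_iff.2 tendsto_src,
    Filter.tendsto_principal.2 self_mem_nhdsWithin⟩).mono_right ?_
  exact comap_nhds_inf_principal_le_nhds EtaleGroupoid.isLocalHomeomorph_src.isOpenMap hV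
    injOn_srcMap hγ

lemma tendsto_units_mul {x : UnitSpace G} {γ δ : Isotropy x} {l : Filter (UnitSpace G)}
    (hγ : Filter.Tendsto Subtype.val l (𝓝 γ.1)) (hδ : Filter.Tendsto Subtype.val l (𝓝 δ.1)) :
    Filter.Tendsto Subtype.val l (𝓝 (γ * δ).1) := by
  have tendsto_diag : Filter.Tendsto (fun z : UnitSpace G => ((z : G), (z : G))) l
      (𝓝[{p : G × G | src p.1 = rng p.2}] (γ.1, δ.1)) :=
    tendsto_nhdsWithin_iff.2 ⟨hγ.prodMk_nhds hδ, Filter.Eventually.of_forall fun z =>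
      z.2.trans (rng_unit z).symm⟩
  exact ((EtaleGroupoid.continuousOn_mul _ (γ.2.1.trans δ.2.2.symm)).tendsto.comp
    tendsto_diag).congr unit_mul_self

lemma tendsto_units_pow {x : UnitSpace G} {γ : Isotropy x} {l : Filter (UnitSpace G)}
    (hx : l ≤ 𝓝 x) (hγ : Filter.Tendsto Subtype.val l (𝓝 γ.1)) (j : ℕ) :
    Filter.Tendsto Subtype.val l (𝓝 (γ ^ j).1) := by
  induction j with
  | zero =>
    rw [pow_zero]
    exact continuous_subtype_val.continuousAt.tendsto.mono_left hx
  | succ j ih =>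
    rw [pow_succ]
    exact tendsto_units_mul ih hγ

/-- `b` is a cutoff function around the arrow `g`, supported in the open bisection `B`. -/
structure IsBump (b : G → ℂ) (g : G) (B : Set G) : Prop where
  isOpenBisection : IsOpenBisection B
  eq_zero_of_notMem : ∀ h ∉ B, b h = 0
  norm_le_one : ∀ h, ‖b h‖ ≤ 1
  eventually_eq_one : ∀ᶠ h in 𝓝 g, b h = 1

lemma exists_isBump {g : G} {O : Set G} (hO : O ∈ 𝓝 g) :
    ∃ b : Cc G, ∃ B ⊆ O, IsBump (b : G → ℂ) g B := by
  have := EtaleGroupoid.locallyCompact (G := G)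
  obtain ⟨B, hB, hgB⟩ := exists_isOpenBisection g
  have hB' : IsOpenBisection (B ∩ interior O) :=
    hB.mono (hB.1.inter isOpen_interior) inter_subset_left
  have := t2Space_of_injOn_src hB'.2.1
  obtain ⟨b, hb, b_zero, b_le, b_one⟩ :=
    exists_mem_Cc_eventually_eq_one hB'.1 ⟨hgB, mem_interior_iff_mem_nhds.2 hO⟩
  exact ⟨⟨b, hb⟩, B ∩ interior O, inter_subset_right.trans interior_subset, hB', b_zero, b_le,
    b_one⟩

namespace IsBump

variable {b : G → ℂ} {g : G} {B : Set G}

lemma apply_self (hb : IsBump b g B) : b g = 1 :=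
  hb.eventually_eq_one.self_of_nhds

lemma mem_of_apply_eq_one (hb : IsBump b g B) {h : G} (hh : b h = 1) : h ∈ B := by
  by_contra hhB
  exact one_ne_zero (hh.symm.trans (hb.eq_zero_of_notMem h hhB))

lemma apply_eq_zero_of_src_eq (hb : IsBump b g B) {h : G} (hs : src h = src g) (hne : h ≠ g) :
    b h = 0 :=
  hb.eq_zero_of_notMem h fun hhB =>
    hne (hb.isOpenBisection.2.1 hhB (hb.mem_of_apply_eq_one hb.apply_self) hs)

lemma isPointMassAt (hb : IsBump b g B) {u : UnitSpace G} (hu : b u = 1) : IsPointMassAt b u :=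
  ⟨hu, fun h hr hne => hb.eq_zero_of_notMem h fun hhB =>
    hne (hb.isOpenBisection.2.2 hhB (hb.mem_of_apply_eq_one hu) (hr.trans (rng_unit u).symm))⟩

end IsBump

lemma exists_bump_on_units {x : UnitSpace G} {P : UnitSpace G → Prop} (hP : ∀ᶠ z in 𝓝 x, P z) :
    ∃ f : Cc G, (f : G → ℂ) x = 1 ∧ (∀ h, ‖(f : G → ℂ) h‖ ≤ 1) ∧
      (∀ h, (f : G → ℂ) h ≠ 0 → src h = h) ∧ ∀ u : UnitSpace G, (f : G → ℂ) u ≠ 0 → P u := by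
  have tendsto_srcMap : Filter.Tendsto (srcMap : G → UnitSpace G) (𝓝 x) (𝓝 x) := by
    simpa only [srcMap_unit] using (continuous_srcMap (G := G)).tendsto (x : G)
  obtain ⟨f, B, hB, hf⟩ :=
    exists_isBump ((eventually_src_eq_self x).and (tendsto_srcMap.eventually hP))
  have mem_B (h : G) (hh : (f : G → ℂ) h ≠ 0) : h ∈ B :=
    not_not.1 fun hhB => hh (hf.eq_zero_of_notMem h hhB)
  refine ⟨f, hf.apply_self, hf.norm_le_one, fun h hh => (hB (mem_B h hh)).1, fun u hu => ?_⟩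
  simpa only [srcMap_unit] using (hB (mem_B u hu)).2

end Etale

section RegularRepresentation

variable {G : Type*} [TopologicalSpace G] [EtaleGroupoid G]

open Classical in
/-- The basis vector `δ_x` of `ℓ²(G_x)`. -/
noncomputable def unitVector (x : UnitSpace G) : Ell2 (SrcFiber x) :=
  lp.single 2 ⟨x, x.2⟩ 1

lemma regOp_unitVector_apply (f : Cc G) {x : UnitSpace G} (g : SrcFiber x) :
    regOp f x (unitVector x) g = (f : G → ℂ) g := by
  classical
  change regFun f x (unitVector x) g = _
  rw [regFun, RegBound.tsum_eq, tsum_eq_single ⟨(x : G), x.2⟩]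
  · rw [unitVector, lp.single_apply_self, mul_one, RegBound.kernel, mul_inv_unit]
  · intro k hk
    rw [unitVector, lp.single_apply_ne _ _ _ hk, mul_zero]

lemma norm_apply_le_norm_regOp_unitVector (f : Cc G) {x : UnitSpace G} (g : SrcFiber x) :
    ‖(f : G → ℂ) g‖ ≤ ‖regOp f x (unitVector x)‖ := by
  rw [← regOp_unitVector_apply]
  exact lp.norm_apply_le_norm two_ne_zero _ g

lemma regOp_apply_of_eq_zero {f : Cc G} {y : UnitSpace G} (ξ : Ell2 (SrcFiber y)) (g : SrcFiber y)
    (hf : ∀ h : G, rng h = rng (g : G) → h ≠ rng (g : G) → (f : G → ℂ) h = 0) :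
    regOp f y ξ g = (f : G → ℂ) (rng (g : G)) * ξ g := by
  change regFun f y ξ g = _
  rw [regFun, tsum_eq_single ⟨rng (g : G), rng_rng _⟩]
  · rw [invMul_rng]
  · intro h hne
    rw [hf h h.2 fun he => hne (Subtype.ext he), zero_mul]

lemma ArrowGroupoid.IsPointMassAt.regOp_apply {v : Cc G} {y : UnitSpace G} {g : SrcFiber y}
    (hv : IsPointMassAt (v : G → ℂ) (rngMap (g : G))) (ξ : Ell2 (SrcFiber y)) :
    regOp v y ξ g = ξ g := by
  rw [regOp_apply_of_eq_zero ξ g hv.2]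
  exact (congrArg (· * ξ g) hv.1).trans (one_mul _)

lemma norm_sq_regOp_le_sum {ι : Type*} [Fintype ι] {v : ι → Cc G} {f : Cc G} {y : UnitSpace G}
    (hf_units : ∀ h, (f : G → ℂ) h ≠ 0 → src h = h) (hf_le : ∀ h, ‖(f : G → ℂ) h‖ ≤ 1)
    (hv : ∀ g : SrcFiber y, (f : G → ℂ) (rng (g : G)) ≠ 0 →
      ∃ k, IsPointMassAt (v k : G → ℂ) (rngMap (g : G)))
    (ξ : Ell2 (SrcFiber y)) :
    ‖regOp f y ξ‖ ^ 2 ≤ ∑ k, ‖regOp (v k) y ξ‖ ^ 2 := by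
  refine hasSum_le (fun g => ?_) (lp_hasSum_norm_sq _)
    (hasSum_sum fun k _ => lp_hasSum_norm_sq (regOp (v k) y ξ))
  have hfg : regOp f y ξ g = (f : G → ℂ) (rng (g : G)) * ξ g := by
    refine regOp_apply_of_eq_zero ξ g fun h hr hne => by_contra fun hh => hne ?_
    rw [← hr, rng_unit ⟨h, hf_units h hh⟩]
  by_cases hg : (f : G → ℂ) (rng (g : G)) = 0
  · rw [hfg, hg, zero_mul, norm_zero, zero_pow two_ne_zero]
    positivity
  · obtain ⟨k, hk⟩ := hv g hg
    calc ‖regOp f y ξ g‖ ^ 2 ≤ ‖regOp (v k) y ξ g‖ ^ 2 := by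
          rw [hfg, hk.regOp_apply, norm_mul]
          gcongr
          exact mul_le_of_le_one_left (norm_nonneg _) (hf_le _)
      _ ≤ ∑ k, ‖regOp (v k) y ξ g‖ ^ 2 :=
          Finset.single_le_sum (f := fun k => ‖regOp (v k) y ξ g‖ ^ 2)
            (fun _ _ => sq_nonneg _) (Finset.mem_univ k)

lemma norm_sq_regOp_average {x : UnitSpace G} {N : ℕ} {γ : Fin N → Isotropy x}
    (hγ : Function.Injective γ) {b : Fin N → Cc G} {B : Fin N → Set G}
    (hb : ∀ j, IsBump (b j : G → ℂ) (γ j).1 (B j)) :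
    ‖regOp ((N : ℂ)⁻¹ • ∑ j, b j) x (unitVector x)‖ ^ 2 = 1 / (N : ℝ) := by
  classical
  let p (j : Fin N) : SrcFiber x := ⟨(γ j).1, (γ j).2.1⟩
  have hp : Function.Injective p := fun i j hij => hγ (Subtype.ext (congrArg Subtype.val hij :))
  have b_apply (j : Fin N) (g : SrcFiber x) :
      (b j : G → ℂ) g = (lp.single 2 (p j) 1 : Ell2 (SrcFiber x)) g := by
    by_cases h : g = p j
    · rw [h, lp.single_apply_self]
      exact (hb j).apply_self
    · rw [lp.single_apply_ne _ _ _ h]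
      exact (hb j).apply_eq_zero_of_src_eq (g.2.trans (p j).2.symm) fun he => h (Subtype.ext he)
  have regOp_eq : regOp ((N : ℂ)⁻¹ • ∑ j, b j) x (unitVector x) =
      (N : ℂ)⁻¹ • ∑ j, (lp.single 2 (p j) 1 : Ell2 (SrcFiber x)) := by
    ext g
    rw [regOp_unitVector_apply, lp.coeFn_smul, Pi.smul_apply, lp.coeFn_sum, Finset.sum_apply]
    simp [b_apply]
  rw [regOp_eq, norm_sq_smul_sum_single hp, Fintype.card_fin, norm_inv, Complex.norm_natCast]
  field_simp

lemma exists_average_powers {x : UnitSpace G} (γ : Isotropy x) {N : ℕ} (hN : 0 < N)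
    (hγ : InjOn (γ ^ ·) (Iio N)) {V : Set G} (hV : IsOpen V) (hinj : InjOn src V)
    (hγV : γ.1 ∈ V) :
    ∃ v : Cc G, ‖regOp v x (unitVector x)‖ ^ 2 = 1 / (N : ℝ) ∧
      ∀ᶠ z : UnitSpace G in 𝓝 x, (z : G) ∈ V → IsPointMassAt (v : G → ℂ) z := by
  choose b B _ hb using fun j : Fin N => exists_isBump (Filter.univ_mem (f := 𝓝 (γ ^ (j : ℕ)).1))
  have pow_injective : Function.Injective fun j : Fin N => γ ^ (j : ℕ) := fun i j hij =>
    Fin.ext (hγ i.2 j.2 hij)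
  refine ⟨(N : ℂ)⁻¹ • ∑ j, b j, norm_sq_regOp_average pow_injective hb, ?_⟩
  have eventually_one : ∀ᶠ z : UnitSpace G in 𝓝[Subtype.val ⁻¹' V] x, ∀ j, (b j : G → ℂ) z = 1 :=
    Filter.eventually_all.2 fun j => (tendsto_units_pow nhdsWithin_le_nhds
      (tendsto_units_isotropy γ hV hinj hγV) j).eventually (hb j).eventually_eq_one
  filter_upwards [eventually_nhdsWithin_iff.1 eventually_one] with z hz hzV
  have hc : (N : ℂ)⁻¹ * Fintype.card (Fin N) = 1 := by
    rw [Fintype.card_fin, inv_mul_cancel₀ (Nat.cast_ne_zero.2 hN.ne')]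
  simpa using isPointMassAt_smul_sum (fun j => (hb j).isPointMassAt (hz hzV j)) hc

/-- The image of `f ∈ C_c(G)` in `C⋆_r(G)`. -/
noncomputable def toReducedCStar (f : Cc G) : ReducedCStar G :=
  ⟨regFamily f, NonUnitalStarSubalgebra.le_topologicalClosure _
    (NonUnitalStarAlgebra.subset_adjoin ℂ _ ⟨f, rfl⟩)⟩

lemma regRep_toReducedCStar (f : Cc G) (x : UnitSpace G) :
    regRep x (toReducedCStar f) = regOp f x :=
  rfl

end RegularRepresentation

/-- In the hypothesis on the orders, `1 / orderOf (g k)` is `0` when `g k` has infinite order, as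
`orderOf (g k) = 0` in this case. -/
theorem proposition1p7 {G : Type*} [TopologicalSpace G] [EtaleGroupoid G]
    (Y : Set (UnitSpace G)) (hY : IsInvariant Y) (x : UnitSpace G) (hx : x ∉ Y)
    (n : ℕ) (hn : 1 ≤ n) (g : Fin n → Isotropy x) (hg : ∀ k, g k ≠ 1)
    (U : Fin n → Set G) (hU : ∀ k, IsOpenBisection (U k)) (hgU : ∀ k, (g k).1 ∈ U k)
    (W : Set (UnitSpace G)) (hW : W ∈ 𝓝 x)
    (hYW : ∀ y ∈ Y ∩ W, ∃ k, (y : G) ∈ U k)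
    (hord : ∑ k, 1 / (orderOf (g k) : ℝ) < 1) :
    ¬ WeaklyContained (regRep x) (directSumRep fun y : Y => regRep (y : UnitSpace G)) := by
  intro weaklyContained
  obtain ⟨N, N_pos, pow_injOn, sum_lt_one⟩ := exists_pos_injOn_pow_sum_lt g hord
  choose v norm_v hv using fun k =>
    exists_average_powers (g k) (N_pos k) (pow_injOn k) (hU k).1 (hU k).2.1 (hgU k)
  have near_x : ∀ᶠ z in 𝓝 x, z ∈ W ∧ ∀ k, (z : G) ∈ U k → IsPointMassAt (v k : G → ℂ) z :=
    Filter.Eventually.and hW (Filter.eventually_all.2 hv)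
  obtain ⟨f, f_x, f_le, f_units, f_near_x⟩ := exists_bump_on_units near_x
  have dominated (y : Y) (ξ : Ell2 (SrcFiber (y : UnitSpace G))) :
      ‖regOp f y ξ‖ ^ 2 ≤ ∑ k, ‖regOp (v k) y ξ‖ ^ 2 := by
    refine norm_sq_regOp_le_sum f_units f_le (fun c hc => ?_) ξ
    obtain ⟨mem_W, isPointMassAt_of_mem⟩ := f_near_x (rngMap (c : G)) hc
    obtain ⟨k, hk⟩ := hYW _ ⟨hY.rngMap_mem y.2 c, mem_W⟩
    exact ⟨k, isPointMassAt_of_mem k hk⟩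
  have dominated_at_x := weaklyContained.norm_sq_le_sum (a := toReducedCStar f)
    (b := fun k => toReducedCStar (v k)) (norm_sq_directSumRep_le_sum dominated) (unitVector x)
  have one_le_norm : 1 ≤ ‖regOp f x (unitVector x)‖ := by
    simpa [f_x] using norm_apply_le_norm_regOp_unitVector f (⟨x, x.2⟩ : SrcFiber x)
  simp only [regRep_toReducedCStar, norm_v] at dominated_at_x
  nlinarith
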